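/- Let $x,y,z$ be elements of a commutative ring. Consider the oriented triangular lattice with vertex set $\mathbb{Z}^2$ (first axis pointing southeast, second axis pointing northeast) and, from each vertex $p$, directed edges to $p+(1,0)$ of weight $x$ (southeast), to $p+(0,1)$ of weight $y$ (northeast) and to $p+(1,1)$ of weight $z$ (horizontal). The weight of a directed path is the product of the weights of its edges, the weight of a pair of paths is the product of their weights, and the total weight $\mathrm{wt}(\mathscr S)$ of a finite set $\mathscr S$ is the sum of the weights of its elements. Let $\mathscr D_{n,k}$ be the set of paths from $(0,0)$ to $(n,k)$ (Delannoy paths), and $\mathscr R_n$ the set of paths from $(0,0)$ to $(n,n)$ all of whose vertices $(p_1,p_2)$ satisfy $p_1\le p_2$ (large Schröder paths). Let $a,c\ge 1$ and $b\ge 0$ be integers, and put $u_1=(0,0)$, $u_2=(a,a)$, $v_1=(a+b,a+b)$, $v_2=(a+b+c,a+b+c)$. Let $\mathscr N_0(a,b,c)$ be the set of pairs $(p_1,p_2)$ of paths with no common vertex such that, for some permutation $\pi$ of $\{1,2\}$, $p_i$ goes from $u_i$ to $v_{\pi(i)}$ for $i=1,2$. Then $$\mathrm{wt}(\mathscr N_0(a,b,c))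 = 2\,xy\;\mathrm{wt}(\mathscr D_{b,b})\sum_{i=1}^{a}\sum_{j=1}^{c}\mathrm{wt}(\mathscr R_{b+i+j-1})\,\mathrm{wt}(\mathscr D_{a-i,a-i})\,\mathrm{wt}(\mathscr D_{c-j,c-j}),$$ where, for all $n,k\ge 0$, $$\mathrm{wt}(\mathscr D_{n,k})=\sum_{i=0}^{n}\binom ni\binom ki x^{n-i}y^{k-i}(xy+z)^i,\qquad \mathrm{wt}(\mathscr R_n)=\sum_{i=0}^{n}\frac1{i+1}\binom{2i}{i}\binom{n+i}{n-i}x^iy^iz^{n-i}.$$ Here terms with $\binom ki=0$ are read as $0$, and $\frac1{i+1}\binom{2i}{i}$ is an integer (the Catalan number). -/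

import Mathlib

/-!
The oriented triangular lattice, in the coordinates in which its vertex set is `ℤ × ℤ`
(positive first axis pointing southeast, positive second axis pointing northeast), its directed
paths, and their weights. -/

namespace TriangularLattice

/-- The three kinds of directed edges of the oriented triangular lattice. -/
inductive Step : Type
  | southeast : Step
  | northeast : Step
  | horizontal : Step

/-- The displacement along an edge. -/
def Step.vec : Step → ℤ × ℤ
  | .southeast => (1, 0)
  | .northeast => (0, 1)
  | .horizontal => (1, 1)

/-- The weight of an edge: `x` for southeast, `y` for northeast, `z` for horizontal edges. -/
def Step.weight {R : Type*} (x y z : R) : Step → R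
  | .southeast => x
  | .northeast => y
  | .horizontal => z

/-- The vertices visited, in order, when starting at `u` and following the steps `p`
(both ends included). -/
def vertices : ℤ × ℤ → List Step → List (ℤ × ℤ)
  | u, [] => [u]
  | u, s :: p => u :: vertices (u + s.vec) p

/-- The directed lattice paths from `u` to `v`, each given by its sequence of steps. -/
def paths (u v : ℤ × ℤ) : Set (List Step) :=
  {p | u + (p.map Step.vec).sum = v}

/-- Delannoy paths: lattice paths from `(0, 0)` to `(n, k)`. -/
def delannoyPaths (n k : ℕ) : Set (List Step) :=
  paths (0, 0) ((n : ℤ), (k : ℤ))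

/-- Large Schröder paths of length `n`: lattice paths from `(0, 0)` to `(n, n)` that never pass
below the diagonal (second coordinate equal to first coordinate). -/
def schroderPaths (n : ℕ) : Set (List Step) :=
  {p | p ∈ paths (0, 0) ((n : ℤ), (n : ℤ)) ∧ ∀ v ∈ vertices (0, 0) p, v.1 ≤ v.2}

/-- The families `(p₁, …, pₘ)` of pairwise vertex-disjoint paths connecting the starting points
`U` to the ending points `V`, with any connection type `π`: the path `pᵢ` goes from `U i` to
`V (π i)`. -/
def nonIntersectingFamilies {m : ℕ} (U V : Fin m → ℤ × ℤ) : Set (Fin m → List Step) :=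
  {P | (∃ π : Equiv.Perm (Fin m), ∀ i, P i ∈ paths (U i) (V (π i))) ∧
    ∀ i j, i ≠ j → List.Disjoint (vertices (U i) (P i)) (vertices (U j) (P j))}

section Weights

variable {R : Type*} [CommRing R] (x y z : R)

/-- The weight of a path: the product of the weights of its edges. -/
def pathWeight (p : List Step) : R :=
  (p.map (Step.weight x y z)).prod

/-- The total weight `wt(D_{n,k})` of the Delannoy paths from `(0, 0)` to `(n, k)`. -/
noncomputable def delannoyWeight (n k : ℕ) : R :=
  ∑ᶠ p ∈ delannoyPaths n k, pathWeight x y z p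

/-- The total weight `wt(R_n)` of the large Schröder paths of length `n`. -/
noncomputable def schroderWeight (n : ℕ) : R :=
  ∑ᶠ p ∈ schroderPaths n, pathWeight x y z p

/-- The total weight of the families of non-intersecting paths connecting `U` to `V`; the weight
of a family is the product of the weights of its paths. -/
noncomputable def nonIntersectingWeight {m : ℕ} (U V : Fin m → ℤ × ℤ) : R :=
  ∑ᶠ P ∈ nonIntersectingFamilies U V, ∏ i, pathWeight x y z (P i)

end Weights

/-! The sets summed over above are finite, so that the sums are genuine finite sums. -/

theorem finite_step : Finite Step :=
  Set.finite_univ_iff.1 ((Set.toFinite {Step.southeast, Step.northeast, Step.horizontal}).subset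
    (by rintro (_ | _ | _) - <;> simp))

theorem length_le_sum (p : List Step) :
    (p.length : ℤ) ≤ (p.map Step.vec).sum.1 + (p.map Step.vec).sum.2 := by
  induction p with
  | nil => simp
  | cons s p ih => cases s <;> simp [Step.vec] <;> omega

theorem finite_paths (u v : ℤ × ℤ) : (paths u v).Finite := by
  have := finite_step
  refine (List.finite_length_le Step ((v.1 - u.1) + (v.2 - u.2)).toNat).subset ?_
  intro p hp
  have h := length_le_sum p
  have hp' : u + (p.map Step.vec).sum = v := hp
  have h1 := congrArg Prod.fst hp'
  have h2 := congrArg Prod.snd hp'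
  simp only [Prod.fst_add, Prod.snd_add] at h1 h2
  simp only [Set.mem_ofPred_eq]
  omega

theorem finite_delannoyPaths (n k : ℕ) : (delannoyPaths n k).Finite :=
  finite_paths _ _

theorem finite_schroderPaths (n : ℕ) : (schroderPaths n).Finite :=
  (finite_paths _ _).subset fun _ hp => hp.1

theorem finite_nonIntersectingFamilies {m : ℕ} (U V : Fin m → ℤ × ℤ) :
    (nonIntersectingFamilies U V).Finite := by
  refine (Set.Finite.pi' (t := fun i => ⋃ j, paths (U i) (V j)) fun i =>
    Set.finite_iUnion fun j => finite_paths _ _).subset ?_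
  rintro P ⟨⟨π, hπ⟩, -⟩ i
  exact Set.mem_iUnion.2 ⟨π i, hπ i⟩

end TriangularLattice

/-! Put `m = a + b` and `N = a + b + c`. Non-intersecting pairs have the same total weight as pairs
consisting of an arbitrary path from `(a, a)` to `(m, m)` and a path from `(0, 0)` to `(N, N)` with
no diagonal vertex between `(a, a)` and `(m, m)`, both included. Splitting the latter at its last
diagonal vertex before `(a, a)` and its first one after `(m, m)` leaves two Delannoy paths and one
excursion on either side of the diagonal. An excursion above, stripped of its first and last steps,
is a large Schröder path. Reflection preserves its weight, so the two sides together give `2xy`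
times a Schröder weight.

The equality of weights comes from a signed version of the Lindström–Gessel–Viennot determinant. Let
`F` be the weight of all paths to `(m, m)`, and `S` the weight of the paths to `(N, N)` signed by
the side on which they pass `(m, m)`. The reflection identity makes paths meeting the diagonal
before `(m, m)` cancel in `S`, which yields the formula defining `signedWeight`. Both `F` and `S`
satisfy the first-step recursion below level `2m`, and `S F' - F S'` is antisymmetric in the two
starting points. Since paths cannot cross without meeting, this expression, signed by the relative
position of the starting points, is the weight of disjoint pairs (`pairWeight_eq_bracket`).

As `S` vanishes at `(a, a)`, only the product of `S` at the other point with `F(a, a)` survives. The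
remaining sign, depending on the side of `(a, a)`, squares the sign in `S`, so the two sides add
instead of cancelling. `pairWeight_eq_mul_sum` carries this back to `(0, 0)`, and
`excursionWeight_zero` evaluates the result. The closed formulas are checked against the first-step
recursions. -/

namespace TriangularLattice

/-! ### Levels and vertices of paths -/

/-- The height of a vertex above the diagonal. -/
def height (w : ℤ × ℤ) : ℤ := w.2 - w.1

/-- The level of a vertex: the sum of its coordinates. -/
def level (w : ℤ × ℤ) : ℤ := w.1 + w.2

theorem level_lt_level_add_vec (u : ℤ × ℤ) (s : Step) : level u < level (u + s.vec) := by
  cases s <;> (simp [level, Step.vec]; try omega)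

theorem mem_paths_nil {u v : ℤ × ℤ} : [] ∈ paths u v ↔ u = v := by
  simp [paths]

theorem mem_paths_cons {u v : ℤ × ℤ} {s : Step} {p : List Step} :
    s :: p ∈ paths u v ↔ p ∈ paths (u + s.vec) v := by
  simp [paths, add_assoc]

theorem mem_vertices_self (u : ℤ × ℤ) (p : List Step) : u ∈ vertices u p := by
  cases p <;> simp [vertices]

theorem eq_or_level_lt_of_mem_vertices {p : List Step} {u w : ℤ × ℤ} (h : w ∈ vertices u p) :
    w = u ∨ level u < level w := by
  induction p generalizing u with
  | nil => simp [vertices] at h; exact Or.inl h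
  | cons s p ih =>
    simp only [vertices, List.mem_cons] at h
    rcases h with h | h
    · exact Or.inl h
    · have := level_lt_level_add_vec u s
      rcases ih h with rfl | h
      · exact Or.inr this
      · exact Or.inr (this.trans h)

theorem target_mem_vertices {p : List Step} {u v : ℤ × ℤ} (h : p ∈ paths u v) :
    v ∈ vertices u p := by
  induction p generalizing u with
  | nil => simp [vertices, mem_paths_nil.1 h]
  | cons s p ih => exact List.mem_cons_of_mem _ (ih (mem_paths_cons.1 h))

theorem level_le_of_mem_paths {p : List Step} {u v : ℤ × ℤ} (h : p ∈ paths u v) :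
    v = u ∨ level u < level v :=
  eq_or_level_lt_of_mem_vertices (target_mem_vertices h)

theorem eq_nil_of_mem_paths_self {p : List Step} {u : ℤ × ℤ} (h : p ∈ paths u u) : p = [] := by
  cases p with
  | nil => rfl
  | cons s p =>
    have h1 := level_le_of_mem_paths (mem_paths_cons.1 h)
    have h2 := level_lt_level_add_vec u s
    rcases h1 with h1 | h1
    · rw [← h1] at h2; omega
    · omega

theorem fst_le_of_mem_vertices {p : List Step} {u w : ℤ × ℤ} (h : w ∈ vertices u p) :
    u.1 ≤ w.1 ∧ u.2 ≤ w.2 := by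
  induction p generalizing u with
  | nil => simp [vertices] at h; simp [h]
  | cons s p ih =>
    simp only [vertices, List.mem_cons] at h
    rcases h with h | h
    · simp [h]
    · have := ih h
      cases s <;> simp [Step.vec] at this <;> omega

theorem vertices_add (u t : ℤ × ℤ) (p : List Step) :
    vertices (u + t) p = (vertices u p).map (· + t) := by
  induction p generalizing u with
  | nil => simp [vertices]
  | cons s p ih => simp [vertices, ← ih, add_right_comm]

theorem paths_add (u v t : ℤ × ℤ) : paths (u + t) (v + t) = paths u v := by
  ext p
  simp only [paths, Set.mem_ofPred_eq, add_right_comm u t, add_left_inj]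

/-! ### Weights of restricted paths -/

section Weights

variable {R : Type*} [CommRing R] (x y z : R)

/-- The sum of the values of `f` at the successors of a vertex, weighted by the edges. -/
def stepSum (f : ℤ × ℤ → R) (w : ℤ × ℤ) : R :=
  x * f (w + (1, 0)) + y * f (w + (0, 1)) + z * f (w + (1, 1))

theorem stepSum_congr {f g : ℤ × ℤ → R} {w : ℤ × ℤ} (h : ∀ s : Step, f (w + s.vec) = g (w + s.vec)) :
    stepSum x y z f w = stepSum x y z g w := by
  have h1 := h .southeast
  have h2 := h .northeast
  have h3 := h .horizontal
  simp only [Step.vec] at h1 h2 h3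
  simp only [stepSum, h1, h2, h3]

theorem stepSum_eq_zero {f : ℤ × ℤ → R} {w : ℤ × ℤ} (h : ∀ s : Step, f (w + s.vec) = 0) :
    stepSum x y z f w = 0 := by
  rw [stepSum_congr x y z (g := fun _ => 0) h]
  simp [stepSum]

theorem stepSum_mul_const (f : ℤ × ℤ → R) (c : R) (w : ℤ × ℤ) :
    stepSum x y z (fun v => f v * c) w = stepSum x y z f w * c := by
  simp only [stepSum]; ring

theorem stepSum_const_mul (f : ℤ × ℤ → R) (c : R) (w : ℤ × ℤ) :
    stepSum x y z (fun v => c * f v) w = c * stepSum x y z f w := by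
  simp only [stepSum]; ring

theorem stepSum_add (f g : ℤ × ℤ → R) (w : ℤ × ℤ) :
    stepSum x y z (fun v => f v + g v) w = stepSum x y z f w + stepSum x y z g w := by
  simp only [stepSum]; ring

theorem stepSum_sum {ι : Type*} (s : Finset ι) (f : ι → ℤ × ℤ → R) (w : ℤ × ℤ) :
    stepSum x y z (fun v => ∑ i ∈ s, f i v) w = ∑ i ∈ s, stepSum x y z (f i) w := by
  simp only [stepSum, Finset.mul_sum, Finset.sum_add_distrib]

theorem pathWeight_cons (s : Step) (p : List Step) :
    pathWeight x y z (s :: p) = s.weight x y z * pathWeight x y z p := by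
  simp [pathWeight]

/-- Sorting a sum over lists of steps, with a parameter, by the first step. -/
theorem finsum_mem_eq_add_of_finite {β : Type*} {A : Set (List Step × β)} (hA : A.Finite)
    (F : List Step × β → R) :
    ∑ᶠ P ∈ A, F P = (∑ᶠ b ∈ {b | ([], b) ∈ A}, F ([], b)) +
      ((∑ᶠ P ∈ {P : List Step × β | (Step.southeast :: P.1, P.2) ∈ A},
          F (Step.southeast :: P.1, P.2)) +
        (∑ᶠ P ∈ {P : List Step × β | (Step.northeast :: P.1, P.2) ∈ A},
          F (Step.northeast :: P.1, P.2)) +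
        (∑ᶠ P ∈ {P : List Step × β | (Step.horizontal :: P.1, P.2) ∈ A},
          F (Step.horizontal :: P.1, P.2))) := by
  have inj (s : Step) : Function.Injective fun P : List Step × β => (s :: P.1, P.2) := by
    rintro ⟨p, b⟩ ⟨q, c⟩ h
    simpa using h
  have inj0 : Function.Injective fun b : β => (([] : List Step), b) := fun b c h => by
    simpa using h
  have key (s : Step) : ∑ᶠ P ∈ {P : List Step × β | (s :: P.1, P.2) ∈ A}, F (s :: P.1, P.2) =
      ∑ᶠ P ∈ A ∩ Set.range (fun P : List Step × β => (s :: P.1, P.2)), F P := by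
    rw [← Set.image_preimage_eq_inter_range, finsum_mem_image (inj s).injOn]
    rfl
  have key0 : ∑ᶠ b ∈ {b | ([], b) ∈ A}, F ([], b) =
      ∑ᶠ P ∈ A ∩ Set.range (fun b : β => (([] : List Step), b)), F P := by
    rw [← Set.image_preimage_eq_inter_range, finsum_mem_image inj0.injOn]
    rfl
  have hdis (s t : Step) (h : s ≠ t) :
      Disjoint (A ∩ Set.range (fun P : List Step × β => (s :: P.1, P.2)))
        (A ∩ Set.range (fun P : List Step × β => (t :: P.1, P.2))) := by
    rw [Set.disjoint_left]
    rintro _ ⟨-, ⟨p, b⟩, rfl⟩ ⟨-, ⟨q, c⟩, h'⟩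
    simp at h'
    exact h h'.1.1.symm
  rw [key, key, key, key0]
  have fin (B : Set (List Step × β)) : (A ∩ B).Finite := hA.inter_of_left B
  rw [← finsum_mem_union (hdis _ _ (by simp)) (fin _) (fin _), ← finsum_mem_union
    (Set.disjoint_union_left.2 ⟨hdis _ _ (by simp), hdis _ _ (by simp)⟩)
      ((fin _).union (fin _)) (fin _), ← finsum_mem_union _ (fin _)
      (((fin _).union (fin _)).union (fin _))]
  · refine congrArg (fun B => ∑ᶠ P ∈ B, F P) (Set.ext fun P => ?_)
    rcases P with ⟨_ | ⟨_ | _ | _, p⟩, b⟩ <;> simp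
  · rw [Set.disjoint_left]
    rintro _ ⟨-, b, rfl⟩ h
    simp at h

/-- The total weight of the paths from `u` to `v` all of whose vertices satisfy `Q`. -/
noncomputable def restrictedWeight (Q : ℤ × ℤ → Prop) (u v : ℤ × ℤ) : R :=
  ∑ᶠ p ∈ {p | p ∈ paths u v ∧ ∀ w ∈ vertices u p, Q w}, pathWeight x y z p

theorem restrictedWeight_eq_zero {Q : ℤ × ℤ → Prop} {u v : ℤ × ℤ}
    (h : ∀ p ∈ paths u v, ¬ ∀ w ∈ vertices u p, Q w) : restrictedWeight x y z Q u v = 0 := by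
  rw [restrictedWeight, show {p | p ∈ paths u v ∧ ∀ w ∈ vertices u p, Q w} = ∅ from
    Set.eq_empty_of_forall_notMem fun p hp => h p hp.1 hp.2]
  simp

theorem restrictedWeight_of_not {Q : ℤ × ℤ → Prop} {u : ℤ × ℤ} (v : ℤ × ℤ) (h : ¬ Q u) :
    restrictedWeight x y z Q u v = 0 :=
  restrictedWeight_eq_zero x y z fun p _ hp => h (hp u (mem_vertices_self u p))

theorem restrictedWeight_of_level_le (Q : ℤ × ℤ → Prop) {u v : ℤ × ℤ} (h : level v ≤ level u)
    (hne : u ≠ v) : restrictedWeight x y z Q u v = 0 := by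
  refine restrictedWeight_eq_zero x y z fun p hp _ => ?_
  rcases level_le_of_mem_paths hp with h' | h'
  · exact hne h'.symm
  · omega

theorem restrictedWeight_self {Q : ℤ × ℤ → Prop} {u : ℤ × ℤ} (h : Q u) :
    restrictedWeight x y z Q u u = 1 := by
  rw [restrictedWeight, show {p | p ∈ paths u u ∧ ∀ w ∈ vertices u p, Q w} = {[]} from ?_,
    finsum_mem_singleton]
  · simp [pathWeight]
  · ext p
    constructor
    · exact fun hp => eq_nil_of_mem_paths_self hp.1
    · rintro rfl
      exact ⟨mem_paths_nil.2 rfl, by simpa [vertices] using h⟩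

theorem restrictedWeight_eq_stepSum {Q : ℤ × ℤ → Prop} {u v : ℤ × ℤ} (hu : Q u) (hne : u ≠ v) :
    restrictedWeight x y z Q u v = stepSum x y z (fun w => restrictedWeight x y z Q w v) u := by
  -- The dummy `Unit` component reuses the first-step decomposition, whose parameter is the
  -- companion path when pairs are treated.
  set A : Set (List Step × Unit) := {P | P.1 ∈ paths u v ∧ ∀ w ∈ vertices u P.1, Q w}
  have hA : A.Finite :=
    ((finite_paths u v).prod (Set.toFinite (Set.univ : Set Unit))).subset fun P hP => ⟨hP.1, trivial⟩
  have conv (B : Set (List Step)) (f : List Step → R) :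
      ∑ᶠ p ∈ B, f p = ∑ᶠ P ∈ {P : List Step × Unit | P.1 ∈ B}, f P.1 := by
    refine (finsum_mem_eq_of_bijOn Prod.fst ⟨fun P hP => hP, fun P _ P' _ h => ?_,
      fun p hp => ⟨(p, ()), hp, rfl⟩⟩ fun P _ => rfl).symm
    exact Prod.ext h rfl
  have e (s : Step) : ∑ᶠ P ∈ {P : List Step × Unit | (s :: P.1, P.2) ∈ A},
      pathWeight x y z (s :: P.1) =
      s.weight x y z * restrictedWeight x y z Q (u + s.vec) v := by
    rw [restrictedWeight, mul_finsum_mem' _ _ ((finite_paths _ _).subset fun p hp => hp.1), conv]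
    simp only [pathWeight_cons]
    refine congrArg (fun B : Set (List Step × Unit) =>
      ∑ᶠ P ∈ B, s.weight x y z * pathWeight x y z P.1) (Set.ext fun P => ?_)
    simp [A, mem_paths_cons, vertices, hu, -Prod.forall]
  have h := finsum_mem_eq_add_of_finite hA (fun P => pathWeight x y z P.1)
  rw [e, e, e] at h
  rw [restrictedWeight, conv]
  refine h.trans ?_
  simp [A, mem_paths_nil, hne, stepSum, Step.weight, Step.vec]

theorem restrictedWeight_add (Q : ℤ × ℤ → Prop) (u v t : ℤ × ℤ) :
    restrictedWeight x y z Q (u + t) (v + t) =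
      restrictedWeight x y z (fun w => Q (w + t)) u v := by
  simp only [restrictedWeight, paths_add, vertices_add, List.forall_mem_map]

end Weights


/-! ### Closed formulas -/

section ClosedForms

variable {R : Type*} [CommRing R] (x y z : R)

theorem restrictedWeight_of_lt (Q : ℤ × ℤ → Prop) {u v : ℤ × ℤ} (h : v.1 < u.1 ∨ v.2 < u.2) :
    restrictedWeight x y z Q u v = 0 := by
  refine restrictedWeight_eq_zero x y z fun p hp _ => ?_
  have := fst_le_of_mem_vertices (target_mem_vertices hp)
  omega

/-- The total weight of all paths from `u` to `v`. -/
noncomputable def freeWeight (u v : ℤ × ℤ) : R :=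
  restrictedWeight x y z (fun _ => True) u v

theorem freeWeight_eq_stepSum {u v : ℤ × ℤ} (hne : u ≠ v) :
    freeWeight x y z u v = stepSum x y z (fun w => freeWeight x y z w v) u :=
  restrictedWeight_eq_stepSum x y z trivial hne

theorem freeWeight_self (u : ℤ × ℤ) : freeWeight x y z u u = 1 :=
  restrictedWeight_self x y z trivial

theorem freeWeight_of_level_le {u v : ℤ × ℤ} (h : level v ≤ level u) (hne : u ≠ v) :
    freeWeight x y z u v = 0 :=
  restrictedWeight_of_level_le x y z _ h hne

theorem delannoyWeight_eq_freeWeight (n k : ℕ) :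
    delannoyWeight x y z n k = freeWeight x y z (0, 0) ((n : ℤ), (k : ℤ)) := by
  simp [delannoyWeight, freeWeight, restrictedWeight, delannoyPaths]

theorem freeWeight_diagonal {i j : ℤ} {n : ℕ} (h : j = i + n) :
    freeWeight x y z (i, i) (j, j) = delannoyWeight x y z n n := by
  rw [delannoyWeight_eq_freeWeight]
  have := restrictedWeight_add x y z (fun _ => True) (0, 0) ((n : ℤ), (n : ℤ)) (i, i)
  simp only [Prod.mk_add_mk, zero_add] at this
  rw [freeWeight, h, add_comm i, this, freeWeight]

theorem schroderWeight_eq_restrictedWeight (n : ℕ) :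
    schroderWeight x y z n =
      restrictedWeight x y z (fun w => w.1 ≤ w.2) (0, 0) ((n : ℤ), (n : ℤ)) :=
  rfl

theorem restrictedWeight_le_diagonal {i j : ℤ} {n : ℕ} (h : j = i + n) :
    restrictedWeight x y z (fun w => w.1 ≤ w.2) (i, i) (j, j) = schroderWeight x y z n := by
  rw [schroderWeight_eq_restrictedWeight]
  have := restrictedWeight_add x y z (fun w => w.1 ≤ w.2) (0, 0) ((n : ℤ), (n : ℤ)) (i, i)
  simp only [Prod.mk_add_mk, zero_add, Prod.fst_add, Prod.snd_add, add_le_add_iff_right] at this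
  rw [h, add_comm i, this]

/-! ### Delannoy polynomials -/

/-- The closed formula for the total weight of the Delannoy paths. -/
def delannoyPoly (n k : ℕ) : R :=
  ∑ i ∈ Finset.range (n + 1),
    (n.choose i : R) * (k.choose i : R) * x ^ (n - i) * y ^ (k - i) * (x * y + z) ^ i

theorem delannoyPoly_zero_left (k : ℕ) : delannoyPoly x y z 0 k = y ^ k := by
  simp [delannoyPoly]

theorem delannoyPoly_zero_right (n : ℕ) : delannoyPoly x y z n 0 = x ^ n := by
  rw [delannoyPoly, Finset.sum_range_succ']
  simp

theorem choose_succ_mul_pow (n i : ℕ) :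
    ((n + 1).choose (i + 1) : R) * x ^ (n + 1 - (i + 1)) =
      x * ((n.choose (i + 1) : R) * x ^ (n - (i + 1))) + (n.choose i : R) * x ^ (n - i) := by
  rw [Nat.choose_succ_succ, Nat.add_sub_add_right]
  rcases lt_or_ge i n with h | h
  · obtain ⟨j, rfl⟩ := Nat.exists_eq_add_of_lt h
    rw [show i + j + 1 - i = j + 1 by omega, show i + j + 1 - (i + 1) = j by omega]
    push_cast
    ring
  · rw [Nat.choose_eq_zero_of_lt (by omega : n < i + 1)]
    simp

/-- Pascal's rule in both binomials, after writing `z = (xy + z) - xy`: the factor `xy + z` shifts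
the summation index by one and `-xy` cancels the surplus product. -/
theorem delannoyPoly_succ_succ (n k : ℕ) :
    delannoyPoly x y z (n + 1) (k + 1) = x * delannoyPoly x y z n (k + 1) +
      y * delannoyPoly x y z (n + 1) k + z * delannoyPoly x y z n k := by
  let A (t : R) (n i : ℕ) : R := (n.choose i : R) * t ^ (n - i)
  have hA (t : R) (n i : ℕ) : A t (n + 1) (i + 1) = t * A t n (i + 1) + A t n i :=
    choose_succ_mul_pow t n i
  have hA0 (t : R) (n : ℕ) : A t (n + 1) 0 = t * A t n 0 := by simp [A, pow_succ']
  have h0 (n k : ℕ) : delannoyPoly x y z n k =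
      ∑ i ∈ Finset.range (n + 1), A x n i * A y k i * (x * y + z) ^ i :=
    Finset.sum_congr rfl fun i _ => by simp only [A]; ring
  have h1 (n k : ℕ) : delannoyPoly x y z (n + 1) k = ∑ i ∈ Finset.range (n + 1),
      A x (n + 1) (i + 1) * A y k (i + 1) * (x * y + z) ^ (i + 1) + A x (n + 1) 0 * A y k 0 := by
    rw [h0, Finset.sum_range_succ']
    simp
  have h2 (n k : ℕ) : delannoyPoly x y z n k = ∑ i ∈ Finset.range (n + 1),
      A x n (i + 1) * A y k (i + 1) * (x * y + z) ^ (i + 1) + A x n 0 * A y k 0 := by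
    have : A x n (n + 1) = 0 := by simp [A]
    rw [h0, ← add_zero (∑ i ∈ Finset.range (n + 1), A x n i * A y k i * (x * y + z) ^ i),
      show (0 : R) = A x n (n + 1) * A y k (n + 1) * (x * y + z) ^ (n + 1) by simp [this],
      ← Finset.sum_range_succ, Finset.sum_range_succ']
    simp
  have h3 : z * delannoyPoly x y z n k =
      ∑ i ∈ Finset.range (n + 1), A x n i * A y k i * (x * y + z) ^ (i + 1) -
        x * y * delannoyPoly x y z n k := by
    rw [eq_sub_iff_add_eq, h0, ← add_mul, Finset.mul_sum]
    exact Finset.sum_congr rfl fun i _ => by ring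
  rw [h3, h1, h1, h2 n (k + 1), h2 n k]
  simp only [hA, hA0, mul_add, Finset.mul_sum]
  rw [← sub_eq_zero]
  have : ∀ a b c d e f g h i j : R, a + b - (c + d + (e + f) + (g - (i + j))) =
    (a - c - e - g + i) + (b - d - f + j) := fun _ _ _ _ _ _ _ _ _ _ => by ring
  rw [this _ _ _ _ _ _ _ 0]
  simp only [← Finset.sum_sub_distrib, ← Finset.sum_add_distrib]
  rw [Finset.sum_eq_zero fun i _ => by ring]
  ring

theorem freeWeight_eq_delannoyPoly (n k : ℤ) (i j : ℕ) :
    freeWeight x y z (n - i, k - j) (n, k) = delannoyPoly x y z i j := by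
  induction hm : i + j using Nat.strong_induction_on generalizing i j with
  | _ m ih =>
    subst hm
    rcases i with _ | i <;> rcases j with _ | j
    · simp [freeWeight_self, delannoyPoly]
    all_goals
      rw [freeWeight_eq_stepSum x y z (by simp; omega)]
      simp only [stepSum, Prod.mk_add_mk]
    · rw [delannoyPoly_zero_left, pow_succ', ← delannoyPoly_zero_left x y z, ← ih _ _ 0 j rfl]
      · rw [freeWeight, restrictedWeight_of_lt x y z _ (Or.inl (by simp)), freeWeight,
          freeWeight, restrictedWeight_of_lt x y z _ (u := (_ + 1, _ + 1)) (Or.inl (by simp)),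
          freeWeight]
        push_cast
        ring_nf
      · omega
    · rw [delannoyPoly_zero_right, pow_succ', ← delannoyPoly_zero_right x y z, ← ih _ _ i 0 rfl]
      · rw [freeWeight, freeWeight, restrictedWeight_of_lt x y z _ (u := (_ + 0, _ + 1))
          (Or.inr (by simp)), freeWeight,
          restrictedWeight_of_lt x y z _ (u := (_ + 1, _ + 1)) (Or.inr (by simp)), freeWeight]
        push_cast
        ring_nf
      · omega
    · rw [delannoyPoly_succ_succ, ← ih _ _ i (j + 1) rfl, ← ih _ _ (i + 1) j rfl,
        ← ih _ _ i j rfl]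
      · push_cast
        ring_nf
      all_goals omega

theorem delannoyWeight_eq (n k : ℕ) : delannoyWeight x y z n k = delannoyPoly x y z n k := by
  rw [delannoyWeight_eq_freeWeight, ← freeWeight_eq_delannoyPoly x y z n k n k]
  simp

/-! ### Ballot numbers and Schröder polynomials -/

/-- The ballot numbers: the number of sequences of `i` up and `i + e` down steps from height `e`
to height `0` that stay nonnegative. -/
def ballot : ℕ → ℕ → ℤ
  | 0, _ => 1
  | i + 1, e => ((2 * (i + 1) + e).choose (i + 1) : ℤ) - ((2 * (i + 1) + e).choose i : ℤ)

theorem ballot_succ_zero (i : ℕ) : ballot (i + 1) 0 = ballot i 1 := by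
  rcases i with _ | i
  · decide
  · have h : (2 * (i + 1) + 1).choose (i + 2) = (2 * (i + 1) + 1).choose (i + 1) := by
      rw [← Nat.choose_symm_half (i + 1)]
    simp only [ballot]
    rw [show 2 * (i + 1 + 1) + 0 = 2 * (i + 1) + 1 + 1 by ring,
      Nat.choose_succ_succ' _ (i + 1), Nat.choose_succ_succ' (2 * (i + 1) + 1) i, h]
    push_cast
    ring

theorem ballot_succ_succ (i e : ℕ) :
    ballot (i + 1) (e + 1) = ballot i (e + 2) + ballot (i + 1) e := by
  rcases i with _ | i
  · simp [ballot]; ring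
  · simp only [ballot]
    rw [show 2 * (i + 1 + 1) + (e + 1) = 2 * (i + 1) + (e + 2) + 1 by ring,
      show 2 * (i + 1 + 1) + e = 2 * (i + 1) + (e + 2) by ring,
      Nat.choose_succ_succ' _ (i + 1), Nat.choose_succ_succ' _ i]
    push_cast
    ring

/-- The ratio of the two neighbouring central binomials turns their difference into the Catalan
quotient; the natural-number division is exact. -/
theorem ballot_zero_right (i : ℕ) : ballot i 0 = ((2 * i).choose i / (i + 1) : ℕ) := by
  rcases i with _ | i
  · simp [ballot]
  · have h := Nat.choose_succ_right_eq (2 * (i + 1)) i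
    rw [show 2 * (i + 1) - i = i + 2 by omega] at h
    have hle : (2 * (i + 1)).choose i ≤ (2 * (i + 1)).choose (i + 1) := by
      by_contra! h'
      nlinarith
    have : (2 * (i + 1)).choose (i + 1) / (i + 1 + 1) =
        (2 * (i + 1)).choose (i + 1) - (2 * (i + 1)).choose i := by
      refine Nat.div_eq_of_eq_mul_left (by omega) ?_
      zify [hle]
      zify at h
      linear_combination -h
    rw [this, Nat.cast_sub hle]
    simp [ballot]

/-- The total weight of the Schröder-like paths from height `e` with `i` northeast, `i + e`
southeast and `h` horizontal steps. -/
def schroderTerm (e i h : ℕ) : R :=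
  (ballot i e : R) * ((2 * i + e + h).choose h : R) * x ^ (i + e) * y ^ i * z ^ h

/-- Horizontal steps keep the height, so they are interleaved freely with a ballot sequence. The
three terms record the first step: Pascal's rule separates the horizontal case, and the ballot
recursion the other two. -/
theorem schroderTerm_succ (e i h : ℕ) :
    schroderTerm x y z (e + 1) i h = x * schroderTerm x y z e i h +
      (if i = 0 then 0 else y * schroderTerm x y z (e + 2) (i - 1) h) +
      (if h = 0 then 0 else z * schroderTerm x y z (e + 1) i (h - 1)) := by
  rcases i with _ | i <;> rcases h with _ | h <;> simp only [schroderTerm]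
  · simp [ballot]; ring
  · rw [show 2 * 0 + (e + 1) + (h + 1) = 2 * 0 + e + (h + 1) + 1 by ring, Nat.choose_succ_succ' _ h]
    simp [ballot, show e + 1 + h = e + (h + 1) by ring]
    ring
  · rw [ballot_succ_succ]
    simp
    ring
  · rw [show 2 * (i + 1) + (e + 1) + (h + 1) = 2 * (i + 1) + e + (h + 1) + 1 by ring,
      Nat.choose_succ_succ' _ h]
    simp only [Nat.add_eq_zero_iff, one_ne_zero, and_false, if_false, Nat.add_sub_cancel]
    rw [show 2 * (i + 1) + (e + 1) + h = 2 * (i + 1) + e + (h + 1) by ring,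
      show 2 * i + (e + 2) + (h + 1) = 2 * (i + 1) + e + (h + 1) by ring, ballot_succ_succ]
    push_cast
    ring

theorem schroderTerm_zero {i h : ℕ} (hih : i + h ≠ 0) :
    schroderTerm x y z 0 i h =
      (if i = 0 then 0 else y * schroderTerm x y z 1 (i - 1) h) +
      (if h = 0 then 0 else z * schroderTerm x y z 0 i (h - 1)) := by
  rcases i with _ | i <;> rcases h with _ | h <;> simp only [schroderTerm]
  · simp at hih
  · simp [ballot]; ring
  · rw [ballot_succ_zero]
    simp
    ring
  · rw [show 2 * (i + 1) + 0 + (h + 1) = 2 * (i + 1) + h + 1 by ring,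
      Nat.choose_succ_succ' _ h]
    simp only [Nat.add_eq_zero_iff, one_ne_zero, and_false, if_false, Nat.add_sub_cancel]
    rw [show 2 * (i + 1) + 0 + h = 2 * (i + 1) + h by ring,
      show 2 * i + 1 + (h + 1) = 2 * (i + 1) + h by ring, ballot_succ_zero]
    push_cast
    ring

/-- The closed formula for the total weight of the Schröder-like paths from height `e` with
`r` northeast or horizontal steps. -/
def schroderPoly (r e : ℕ) : R :=
  ∑ P ∈ Finset.HasAntidiagonal.antidiagonal r, schroderTerm x y z e P.1 P.2

theorem schroderPoly_zero_left (e : ℕ) : schroderPoly x y z 0 e = x ^ e := by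
  simp [schroderPoly, schroderTerm, ballot]

theorem sum_antidiagonal_shift_left (r : ℕ) (c : R) (f : ℕ → ℕ → R) :
    ∑ P ∈ Finset.HasAntidiagonal.antidiagonal (r + 1), (if P.1 = 0 then 0 else c * f (P.1 - 1) P.2) =
      c * ∑ P ∈ Finset.HasAntidiagonal.antidiagonal r, f P.1 P.2 := by
  rw [Finset.Nat.sum_antidiagonal_succ]
  simp [Finset.mul_sum]

theorem sum_antidiagonal_shift_right (r : ℕ) (c : R) (f : ℕ → ℕ → R) :
    ∑ P ∈ Finset.HasAntidiagonal.antidiagonal (r + 1), (if P.2 = 0 then 0 else c * f P.1 (P.2 - 1)) =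
      c * ∑ P ∈ Finset.HasAntidiagonal.antidiagonal r, f P.1 P.2 := by
  rw [Finset.Nat.sum_antidiagonal_succ']
  simp [Finset.mul_sum]

theorem schroderPoly_succ_succ (r e : ℕ) :
    schroderPoly x y z (r + 1) (e + 1) = x * schroderPoly x y z (r + 1) e +
      y * schroderPoly x y z r (e + 2) + z * schroderPoly x y z r (e + 1) := by
  simp only [schroderPoly]
  rw [Finset.sum_congr rfl fun P _ => schroderTerm_succ x y z e P.1 P.2,
    Finset.sum_add_distrib, Finset.sum_add_distrib,
    sum_antidiagonal_shift_left r y (schroderTerm x y z (e + 2)),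
    sum_antidiagonal_shift_right r z (schroderTerm x y z (e + 1)), ← Finset.mul_sum]

theorem schroderPoly_succ_zero (r : ℕ) :
    schroderPoly x y z (r + 1) 0 =
      y * schroderPoly x y z r 1 + z * schroderPoly x y z r 0 := by
  simp only [schroderPoly]
  rw [Finset.sum_congr rfl fun P hP => schroderTerm_zero x y z
      (by rw [Finset.HasAntidiagonal.mem_antidiagonal.1 hP]; omega : P.1 + P.2 ≠ 0),
    Finset.sum_add_distrib, sum_antidiagonal_shift_left r y (schroderTerm x y z 1),
    sum_antidiagonal_shift_right r z (schroderTerm x y z 0)]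

theorem restrictedWeight_le_eq_schroderPoly (n : ℤ) (r e : ℕ) :
    restrictedWeight x y z (fun w => w.1 ≤ w.2) (n - r - e, n - r) (n, n) =
      schroderPoly x y z r e := by
  -- `2 * r + e` is the difference of levels between the target and the starting point.
  induction hm : 2 * r + e using Nat.strong_induction_on generalizing r e with
  | _ m ih =>
    subst hm
    rcases r with _ | r <;> rcases e with _ | e
    · simp only [Nat.cast_zero, sub_zero, schroderPoly_zero_left, pow_zero]
      exact restrictedWeight_self x y z le_rfl
    all_goals
      rw [restrictedWeight_eq_stepSum x y z (by simp only; omega)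
        (by simp only [ne_eq, Prod.mk.injEq]; omega)]
      simp only [stepSum, Prod.mk_add_mk]
    · rw [schroderPoly_zero_left, pow_succ', ← schroderPoly_zero_left x y z, ← ih _ _ 0 e rfl]
      · rw [restrictedWeight_of_lt x y z _ (u := (_ + 0, _ + 1)) (Or.inr (by simp)),
          restrictedWeight_of_lt x y z _ (u := (_ + 1, _ + 1)) (Or.inr (by simp))]
        push_cast
        ring_nf
      · omega
    · rw [schroderPoly_succ_zero, ← ih _ _ r 1 rfl, ← ih _ _ r 0 rfl,
        restrictedWeight_of_not x y z (u := (_ + 1, _ + 0)) _ (by simp)]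
      · push_cast
        ring_nf
      all_goals omega
    · rw [schroderPoly_succ_succ, ← ih _ _ r (e + 2) rfl, ← ih _ _ (r + 1) e rfl,
        ← ih _ _ r (e + 1) rfl]
      · push_cast
        ring_nf
      all_goals omega

theorem schroderWeight_eq (n : ℕ) :
    schroderWeight x y z n = ∑ i ∈ Finset.range (n + 1),
      (((2 * i).choose i / (i + 1) : ℕ) : R) * ((n + i).choose (n - i) : R) *
        x ^ i * y ^ i * z ^ (n - i) := by
  have h := restrictedWeight_le_eq_schroderPoly x y z n n 0
  rw [Nat.cast_zero, sub_zero, sub_self, ← schroderWeight_eq_restrictedWeight] at h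
  rw [h, schroderPoly, Finset.Nat.sum_antidiagonal_eq_sum_range_succ_mk]
  refine Finset.sum_congr rfl fun i hi => ?_
  have hi : i ≤ n := Finset.mem_range_succ_iff.1 hi
  simp only [schroderTerm, ballot_zero_right, Int.cast_natCast, add_zero]
  rw [show 2 * i + (n - i) = n + i by omega]

end ClosedForms


/-! ### First passage to the diagonal -/

section FirstPassage

variable {R : Type*} [CommRing R] (x y z : R)

/-- The total weight of the paths from `w` to `(n, n)` that do not meet the diagonal earlier. -/
noncomputable def firstPassage (n : ℤ) (w : ℤ × ℤ) : R :=
  restrictedWeight x y z (fun v => v.1 = v.2 → v = (n, n)) w (n, n)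

theorem firstPassage_self (n : ℤ) : firstPassage x y z n (n, n) = 1 :=
  restrictedWeight_self x y z fun _ => rfl

theorem firstPassage_of_height_eq_zero {n : ℤ} {w : ℤ × ℤ} (hw : height w = 0)
    (hne : w ≠ (n, n)) : firstPassage x y z n w = 0 :=
  restrictedWeight_of_not x y z _ fun h => hne (h (by simp only [height] at hw; omega))

theorem firstPassage_of_level_le {n : ℤ} {w : ℤ × ℤ} (h : 2 * n ≤ level w) (hne : w ≠ (n, n)) :
    firstPassage x y z n w = 0 :=
  restrictedWeight_of_level_le x y z _ (by simp only [level] at *; omega) hne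

theorem firstPassage_eq_stepSum {n : ℤ} {w : ℤ × ℤ} (hw : height w ≠ 0) :
    firstPassage x y z n w = stepSum x y z (firstPassage x y z n) w := by
  have h : w.1 ≠ w.2 := by simp only [height] at hw; omega
  refine restrictedWeight_eq_stepSum x y z (fun h' => absurd h' h) ?_
  rintro rfl
  exact h rfl

/-- Reflection in the diagonal exchanges `x` and `y`. A path from height `e` to the diagonal has `e`
more southeast than northeast steps, so its weight is `x ^ e` times a monomial in `xy` and `z`,
which reflection fixes. The common factor `g` avoids dividing by `x` or `y`. -/
theorem exists_firstPassage_reflection (n k : ℤ) (e : ℕ) :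
    ∃ g : R, firstPassage x y z n (k, k + e) = x ^ e * g ∧
      firstPassage x y z n (k + e, k) = y ^ e * g := by
  induction hm : (2 * n - (2 * k + e)).toNat using Nat.strong_induction_on generalizing k e with
  | _ m ih =>
    subst hm
    rcases e with _ | e
    · exact ⟨firstPassage x y z n (k, k), by simp⟩
    rcases lt_or_ge (2 * k + (e + 1 : ℕ)) (2 * n) with h | h
    · obtain ⟨g1, h1, h1'⟩ := ih _ (by push_cast at *; omega) (k + 1) e rfl
      obtain ⟨g2, h2, h2'⟩ := ih _ (by push_cast at *; omega) k (e + 2) rfl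
      obtain ⟨g3, h3, h3'⟩ := ih _ (by push_cast at *; omega) (k + 1) (e + 1) rfl
      refine ⟨g1 + x * y * g2 + z * g3, ?_, ?_⟩ <;>
      · rw [firstPassage_eq_stepSum x y z (by simp only [height]; push_cast; omega)]
        simp only [stepSum, Prod.mk_add_mk]
        push_cast at *
        ring_nf at *
        simp only [h1, h2, h3, h1', h2', h3']
        ring
    · refine ⟨0, ?_, ?_⟩ <;>
      · rw [mul_zero]
        exact firstPassage_of_level_le x y z (by simp only [level]; push_cast at *; omega)
          (by simp only [ne_eq, Prod.mk.injEq]; push_cast at *; omega)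

theorem mul_firstPassage_reflection (n k : ℤ) :
    y * firstPassage x y z n (k, k + 1) = x * firstPassage x y z n (k + 1, k) := by
  obtain ⟨g, h, h'⟩ := exists_firstPassage_reflection x y z n k 1
  rw [Nat.cast_one] at h h'
  rw [h, h']
  ring

/-- A path strictly above the diagonal must enter it by a southeast step from `(n - 1, n)`; removing
that step and translating by `(0, -1)` leaves a weakly-above path. -/
theorem firstPassage_above (n : ℤ) {w : ℤ × ℤ} (hw : w.1 ≤ w.2) :
    firstPassage x y z n (w + (0, 1)) =
      x * restrictedWeight x y z (fun w => w.1 ≤ w.2) w (n - 1, n - 1) := by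
  induction hm : (2 * n - level w).toNat using Nat.strong_induction_on generalizing w with
  | _ m ih =>
    subst hm
    obtain ⟨p, q⟩ := w
    simp only at hw
    have hl : level (p, q) = p + q := rfl
    rcases eq_or_ne (p, q) (n - 1, n - 1) with h | h
    · simp only [Prod.mk.injEq] at h
      obtain ⟨rfl, rfl⟩ := h
      rw [restrictedWeight_self x y z (Q := fun w => w.1 ≤ w.2) le_rfl,
        firstPassage_eq_stepSum x y z (by simp [height])]
      simp only [stepSum, Prod.mk_add_mk]
      rw [firstPassage_of_level_le x y z (w := (_ + 0, _)) (by simp [level]; omega) (by simp),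
        firstPassage_of_level_le x y z (w := (_, _ + 1 + 1)) (by simp [level]; omega) (by simp)]
      simp [firstPassage_self]
    rcases le_or_gt (2 * n - 2) (p + q) with h' | h'
    · rw [restrictedWeight_of_level_le x y z _ (by simp [level]; omega) h, mul_zero]
      simp only [ne_eq, Prod.mk.injEq] at h
      exact restrictedWeight_of_lt x y z _ (Or.inr (by simp; omega))
    · rw [firstPassage_eq_stepSum x y z (by simp [height]; omega),
        restrictedWeight_eq_stepSum x y z hw h, ← stepSum_const_mul]
      have key (s : Step) : firstPassage x y z n ((p, q) + s.vec + (0, 1)) =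
          x * restrictedWeight x y z (fun w => w.1 ≤ w.2) ((p, q) + s.vec) (n - 1, n - 1) := by
        have hs := level_lt_level_add_vec (p, q) s
        by_cases hle : ((p, q) + s.vec).1 ≤ ((p, q) + s.vec).2
        · exact ih _ (by omega) hle rfl
        · rw [restrictedWeight_of_not x y z (u := (p, q) + s.vec) _ hle, mul_zero]
          simp only [ne_eq, Prod.mk.injEq] at h
          cases s <;> simp [Step.vec] at hle
          · exact firstPassage_of_height_eq_zero x y z (by simp [height, Step.vec]; omega)
              (by simp [Step.vec]; omega)
          all_goals omega
      rw [← stepSum_congr x y z (f := fun v => firstPassage x y z n (v + (0, 1)))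
        (g := fun v => x * restrictedWeight x y z (fun w => w.1 ≤ w.2) v (n - 1, n - 1)) key]
      simp only [stepSum, Prod.mk_add_mk]
      ring_nf

theorem firstPassage_succ (k : ℤ) (r : ℕ) :
    firstPassage x y z (k + r + 1) (k, k + 1) = x * schroderWeight x y z r := by
  have h := firstPassage_above x y z (k + r + 1) (w := (k, k)) le_rfl
  rw [add_sub_cancel_right, restrictedWeight_le_diagonal x y z (n := r) rfl] at h
  simpa using h

/-- Splitting paths at their first vertex on the diagonal. -/
theorem freeWeight_eq_sum_firstPassage (m N : ℕ) {w : ℤ × ℤ} (h : 2 * (m : ℤ) ≤ level w)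
    (hne : w ≠ ((m : ℤ), (m : ℤ))) :
    freeWeight x y z w ((N : ℤ), (N : ℤ)) = ∑ n ∈ Finset.Ioc m N,
      firstPassage x y z n w * delannoyWeight x y z (N - n) (N - n) := by
  induction hm : (2 * (N : ℤ) - level w).toNat using Nat.strong_induction_on generalizing w with
  | _ k ih =>
    subst hm
    by_cases hw : height w = 0
    · obtain ⟨i, j⟩ := w
      obtain rfl : j = i := by simp only [height] at hw; omega
      simp only [level, ne_eq, Prod.mk.injEq, and_self] at h hne
      lift j to ℕ using by omega
      rcases le_or_gt j N with hj | hj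
      · rw [Finset.sum_eq_single_of_mem j (Finset.mem_Ioc.2 (by omega)), firstPassage_self, one_mul,
          freeWeight_diagonal x y z (n := N - j) (by omega)]
        intro n _ hn
        rw [firstPassage_of_height_eq_zero x y z hw (by simpa using hn.symm), zero_mul]
      · rw [freeWeight_of_level_le x y z (by simp only [level]; omega)
          (by simp only [ne_eq, Prod.mk.injEq]; omega), Finset.sum_eq_zero]
        intro n hn
        rw [firstPassage_of_height_eq_zero x y z hw, zero_mul]
        have := Finset.mem_Ioc.1 hn
        simp only [ne_eq, Prod.mk.injEq]
        omega
    · have hne' (i : ℤ) : w ≠ (i, i) := by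
        rintro rfl
        simp [height] at hw
      rcases le_or_gt (2 * (N : ℤ)) (level w) with hN | hN
      · rw [freeWeight_of_level_le x y z (by simp only [level] at *; omega) (hne' N),
          Finset.sum_eq_zero]
        intro n hn
        have := Finset.mem_Ioc.1 hn
        rw [firstPassage_of_level_le x y z (by omega) (hne' n), zero_mul]
      · rw [freeWeight_eq_stepSum x y z (hne' N)]
        simp_rw [firstPassage_eq_stepSum x y z hw, ← stepSum_mul_const, ← stepSum_sum]
        refine stepSum_congr x y z fun s => ih _ ?_ ?_ ?_ rfl
        · have := level_lt_level_add_vec w s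
          omega
        · have := level_lt_level_add_vec w s
          omega
        · intro h'
          have := level_lt_level_add_vec w s
          rw [h'] at this
          simp only [level] at this h
          omega

/-! ### Paths signed by side -/

/-- The total weight of the paths from `w` to `(N, N)`, signed by the side on which they pass
`(m, m)`. -/
noncomputable def signedWeight (m N : ℕ) (w : ℤ × ℤ) : R :=
  ∑ n ∈ Finset.Ioc m N, (Int.sign (height w) : R) * firstPassage x y z n w *
    delannoyWeight x y z (N - n) (N - n)

theorem signedWeight_of_le_level {m N : ℕ} {w : ℤ × ℤ} (h : 2 * (m : ℤ) ≤ level w) :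
    signedWeight x y z m N w =
      (Int.sign (height w) : R) * freeWeight x y z w ((N : ℤ), (N : ℤ)) := by
  by_cases hw : height w = 0
  · simp [signedWeight, hw]
  · rw [freeWeight_eq_sum_firstPassage x y z m N h, Finset.mul_sum]
    · simp [signedWeight, mul_assoc]
    · rintro rfl
      simp [height] at hw

theorem sign_height_add_vec {w : ℤ × ℤ} (hw : height w ≠ 0) (s : Step) :
    height (w + s.vec) = 0 ∨ (height (w + s.vec)).sign = (height w).sign := by
  rcases lt_or_gt_of_ne hw with h | h
  · by_cases h' : height (w + s.vec) = 0
    · exact Or.inl h'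
    · rw [Int.sign_eq_neg_one_of_neg h, Int.sign_eq_neg_one_of_neg]
      · exact Or.inr rfl
      · cases s <;> simp [height, Step.vec] at * <;> omega
  · by_cases h' : height (w + s.vec) = 0
    · exact Or.inl h'
    · rw [Int.sign_eq_one_of_pos h, Int.sign_eq_one_of_pos]
      · exact Or.inr rfl
      · cases s <;> simp [height, Step.vec] at * <;> omega

theorem add_vec_ne_of_level_lt {n : ℤ} {w : ℤ × ℤ} (h : level w + 2 < 2 * n) (s : Step) :
    w + s.vec ≠ (n, n) := by
  intro h'
  have : level (w + s.vec) = 2 * n := by rw [h']; simp only [level]; ring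
  cases s <;> simp [level, Step.vec] at * <;> omega

/-- Off the diagonal the sign is constant until the first passage vanishes. On the diagonal the
contributions of the two sides cancel by reflection. The level bound keeps every successor away from
`(n, n)`, where the sign is `0` but the first passage is `1`. -/
theorem sign_mul_firstPassage_eq_stepSum {n : ℤ} {w : ℤ × ℤ} (h : level w + 2 < 2 * n) :
    (Int.sign (height w) : R) * firstPassage x y z n w =
      stepSum x y z (fun v => (Int.sign (height v) : R) * firstPassage x y z n v) w := by
  by_cases hw : height w = 0
  · obtain ⟨i, j⟩ := w
    obtain rfl : j = i := by simp only [height] at hw; omega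
    have := mul_firstPassage_reflection x y z n j
    simp [stepSum, height]
    linear_combination -this
  · rw [firstPassage_eq_stepSum x y z hw, ← stepSum_const_mul]
    refine stepSum_congr x y z fun s => ?_
    rcases sign_height_add_vec hw s with h' | h'
    · rw [firstPassage_of_height_eq_zero x y z h' (add_vec_ne_of_level_lt h s)]
      simp
    · rw [h']

theorem signedWeight_eq_stepSum {m N : ℕ} {w : ℤ × ℤ} (h : level w < 2 * (m : ℤ)) :
    signedWeight x y z m N w = stepSum x y z (signedWeight x y z m N) w := by
  have : signedWeight x y z m N = fun w => ∑ n ∈ Finset.Ioc m N,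
    (Int.sign (height w) : R) * firstPassage x y z n w *
      delannoyWeight x y z (N - n) (N - n) := rfl
  rw [this]
  simp only [stepSum_sum, stepSum_mul_const]
  refine Finset.sum_congr rfl fun n hn => ?_
  have := Finset.mem_Ioc.1 hn
  rw [sign_mul_firstPassage_eq_stepSum x y z (by omega)]

theorem signedWeight_of_height_eq_zero {m N : ℕ} {w : ℤ × ℤ} (h : height w = 0) :
    signedWeight x y z m N w = 0 := by
  simp [signedWeight, h]

/-! ### Excursions avoiding a diagonal segment -/

/-- The total weight of the paths from `w` to `(n, n)` that do not meet the diagonal between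
`(a, a)` and `(n - 1, n - 1)`, both included. -/
noncomputable def excursionWeight (a n : ℕ) (w : ℤ × ℤ) : R :=
  (Int.sign (height w) : R) * ((Int.sign (height w) : R) * firstPassage x y z n w) +
    ∑ k ∈ Finset.range a, freeWeight x y z w ((k : ℤ), (k : ℤ)) *
      stepSum x y z (firstPassage x y z n) ((k : ℤ), (k : ℤ))

theorem excursionWeight_of_le_level {a n : ℕ} {w : ℤ × ℤ} (h : 2 * (a : ℤ) ≤ level w) :
    excursionWeight x y z a n w =
      (Int.sign (height w) : R) * ((Int.sign (height w) : R) * firstPassage x y z n w) := by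
  rw [excursionWeight, Finset.sum_eq_zero, add_zero]
  intro k hk
  have := Finset.mem_range.1 hk
  rw [freeWeight_of_level_le x y z (by simp only [level] at *; omega), zero_mul]
  rintro rfl
  simp only [level] at h
  omega

theorem sign_mul_sign_mul {w : ℤ × ℤ} (hw : height w ≠ 0) (r : R) :
    (Int.sign (height w) : R) * ((Int.sign (height w) : R) * r) = r := by
  rcases lt_or_gt_of_ne hw with h | h
  · simp [Int.sign_eq_neg_one_of_neg h]
  · simp [Int.sign_eq_one_of_pos h]

theorem sign_mul_sign_mul_firstPassage {n : ℤ} {w : ℤ × ℤ} (hw : w ≠ (n, n)) :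
    (Int.sign (height w) : R) * ((Int.sign (height w) : R) * firstPassage x y z n w) =
      firstPassage x y z n w := by
  by_cases h : height w = 0
  · rw [firstPassage_of_height_eq_zero x y z h hw]
    simp
  · exact sign_mul_sign_mul h _

/-- The sum over `k` splits paths at their last diagonal vertex `(k, k)` before `(a, a)`. At `w =
(k, k)` its own term supplies exactly the step sum of the first passage, which the squared-sign
term, being zero there, fails to account for. -/
theorem excursionWeight_eq_stepSum {a n : ℕ} (han : a < n) {w : ℤ × ℤ} (h : level w < 2 * (a : ℤ))
    (h0 : 0 ≤ w.1) :
    excursionWeight x y z a n w = stepSum x y z (excursionWeight x y z a n) w := by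
  have : excursionWeight x y z a n = fun w =>
    (Int.sign (height w) : R) * ((Int.sign (height w) : R) * firstPassage x y z n w) +
    ∑ k ∈ Finset.range a, freeWeight x y z w ((k : ℤ), (k : ℤ)) *
      stepSum x y z (firstPassage x y z n) ((k : ℤ), (k : ℤ)) := rfl
  rw [this]
  simp only [stepSum_add, stepSum_sum, stepSum_mul_const]
  rw [stepSum_congr x y z fun s => sign_mul_sign_mul_firstPassage x y z
    (add_vec_ne_of_level_lt (by omega) s)]
  by_cases hw : height w = 0
  · obtain ⟨i, j⟩ := w
    obtain rfl : j = i := by simp only [height] at hw; omega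
    simp only [level] at h h0
    lift j to ℕ using h0
    have hj : j ∈ Finset.range a := Finset.mem_range.2 (by omega)
    rw [← Finset.add_sum_erase _ _ hj, ← Finset.add_sum_erase _ _ hj, freeWeight_self,
      stepSum_eq_zero x y z (f := fun v => freeWeight x y z v ((j : ℤ), (j : ℤ)))]
    · rw [hw, Finset.sum_congr rfl fun k hk => by
        rw [freeWeight_eq_stepSum x y z
          (by simpa using (Finset.ne_of_mem_erase hk).symm :
            ((j : ℤ), (j : ℤ)) ≠ ((k : ℤ), (k : ℤ)))]]
      simp
    · intro s
      have := level_lt_level_add_vec ((j : ℤ), (j : ℤ)) s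
      refine freeWeight_of_level_le x y z this.le fun h' => ?_
      rw [h'] at this
      exact this.ne rfl
  · have hne (i : ℤ) : w ≠ (i, i) := by
      rintro rfl
      simp [height] at hw
    rw [sign_mul_sign_mul hw, firstPassage_eq_stepSum x y z hw]
    congr 1
    exact Finset.sum_congr rfl fun k _ => by rw [freeWeight_eq_stepSum x y z (hne k)]

/-- From `(k, k)` an excursion starts to either side; both sides weigh the same by reflection,
whence the factor `2`. The substitution is `i = a - k`. -/
theorem excursionWeight_zero (a r : ℕ) :
    excursionWeight x y z a (a + r + 1) (0, 0) = 2 * (x * y) * ∑ i ∈ Finset.Icc 1 a,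
      delannoyWeight x y z (a - i) (a - i) * schroderWeight x y z (r + i) := by
  rw [excursionWeight, Finset.mul_sum]
  simp only [height, sub_self, Int.sign_zero, Int.cast_zero, zero_mul, zero_add]
  refine Finset.sum_bij' (fun k _ => a - k) (fun i _ => a - i) ?_ ?_ ?_ ?_ ?_
  · intro k hk
    have := Finset.mem_range.1 hk
    exact Finset.mem_Icc.2 (by omega)
  · intro i hi
    have := Finset.mem_Icc.1 hi
    exact Finset.mem_range.2 (by omega)
  · intro k hk
    have := Finset.mem_range.1 hk
    omega
  · intro i hi
    have := Finset.mem_Icc.1 hi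
    omega
  · intro k hk
    have hk := Finset.mem_range.1 hk
    have h := mul_firstPassage_reflection x y z (a + r + 1 : ℕ) k
    have h' := firstPassage_succ x y z k (r + (a - k))
    rw [show (k : ℤ) + (r + (a - k) : ℕ) + 1 = (a + r + 1 : ℕ) by omega] at h'
    rw [freeWeight_diagonal x y z (n := k) (by simp), show a - (a - k) = k by omega]
    have hz : firstPassage x y z (a + r + 1 : ℕ) ((k : ℤ) + 1, (k : ℤ) + 1) = 0 :=
      firstPassage_of_height_eq_zero x y z (by simp [height])
        (by simp only [ne_eq, Prod.mk.injEq]; omega)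
    simp only [stepSum, Prod.mk_add_mk, add_zero, hz]
    rw [← h, h']
    ring

end FirstPassage


/-! ### Pairs of disjoint paths -/

section Pairs

variable {R : Type*} [CommRing R] (x y z : R)

/-- The pairs of disjoint paths from `u` and `u'` to `v` and `v'`, in either order. -/
def disjointPairs (v v' u u' : ℤ × ℤ) : Set (List Step × List Step) :=
  {P | ((P.1 ∈ paths u v ∧ P.2 ∈ paths u' v') ∨ (P.1 ∈ paths u v' ∧ P.2 ∈ paths u' v)) ∧
    List.Disjoint (vertices u P.1) (vertices u' P.2)}

theorem finite_disjointPairs (v v' u u' : ℤ × ℤ) : (disjointPairs v v' u u').Finite :=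
  (((finite_paths u v).prod (finite_paths u' v')).union
    ((finite_paths u v').prod (finite_paths u' v))).subset fun _ hP => hP.1

/-- The total weight of the pairs of disjoint paths from `u` and `u'` to `v` and `v'`, in either
order. -/
noncomputable def pairWeight (v v' u u' : ℤ × ℤ) : R :=
  ∑ᶠ P ∈ disjointPairs v v' u u', pathWeight x y z P.1 * pathWeight x y z P.2

theorem pairWeight_comm (v v' u u' : ℤ × ℤ) :
    pairWeight x y z v v' u u' = pairWeight x y z v v' u' u := by
  refine finsum_mem_eq_of_bijOn Prod.swap ⟨?_, Prod.swap_injective.injOn, ?_⟩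
    fun P _ => mul_comm _ _
  · rintro ⟨p, q⟩ ⟨h, hd⟩
    exact ⟨h.symm.imp And.symm And.symm, hd.symm⟩
  · rintro ⟨p, q⟩ ⟨h, hd⟩
    exact ⟨(q, p), ⟨h.symm.imp And.symm And.symm, hd.symm⟩, rfl⟩

theorem pairWeight_self (v v' u : ℤ × ℤ) : pairWeight x y z v v' u u = 0 := by
  rw [pairWeight, show disjointPairs v v' u u = ∅ from Set.eq_empty_of_forall_notMem fun P hP =>
    hP.2 (mem_vertices_self u P.1) (mem_vertices_self u P.2)]
  simp

/-- Only the lagging path is advanced: the other one stays at levels at least that of `u` and cannot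
visit `u`, so dropping `u` does not affect disjointness. -/
theorem pairWeight_eq_stepSum {v v' u u' : ℤ × ℤ} (h : level u ≤ level u') (hne : u ≠ u')
    (hv : u ≠ v) (hv' : u ≠ v') :
    pairWeight x y z v v' u u' = stepSum x y z (fun w => pairWeight x y z v v' w u') u := by
  have hu (q : List Step) : u ∉ vertices u' q := fun hq => by
    rcases eq_or_level_lt_of_mem_vertices hq with h' | h'
    · exact hne h'
    · omega
  have e (s : Step) : ∑ᶠ P ∈ {P : List Step × List Step | (s :: P.1, P.2) ∈
      disjointPairs v v' u u'}, pathWeight x y z (s :: P.1) * pathWeight x y z P.2 =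
      s.weight x y z * pairWeight x y z v v' (u + s.vec) u' := by
    rw [pairWeight, mul_finsum_mem' _ _ (finite_disjointPairs _ _ _ _)]
    simp only [pathWeight_cons, mul_assoc]
    refine congrArg (fun B : Set (List Step × List Step) =>
      ∑ᶠ P ∈ B, s.weight x y z * (pathWeight x y z P.1 * pathWeight x y z P.2))
      (Set.ext fun P => ?_)
    simp [disjointPairs, mem_paths_cons, vertices, hu]
  refine (finsum_mem_eq_add_of_finite (finite_disjointPairs v v' u u')
    (fun P => pathWeight x y z P.1 * pathWeight x y z P.2)).trans ?_
  rw [e, e, e]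
  simp [disjointPairs, mem_paths_nil, hv, hv', stepSum, Step.weight, Step.vec]

theorem pairWeight_eq_zero {v v' u u' : ℤ × ℤ} (h : level v ≤ level u) (h' : level v ≤ level u')
    (hv : u ≠ v) (hv' : u' ≠ v) : pairWeight x y z v v' u u' = 0 := by
  rw [pairWeight, show disjointPairs v v' u u' = ∅ from ?_]
  · simp
  refine Set.eq_empty_of_forall_notMem fun P hP => ?_
  rcases hP.1 with hP | hP
  · rcases level_le_of_mem_paths hP.1 with h1 | h1
    · exact hv h1.symm
    · omega
  · rcases level_le_of_mem_paths hP.2 with h1 | h1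
    · exact hv' h1.symm
    · omega

theorem pairWeight_target {v v' u' : ℤ × ℤ} (h : level v ≤ level u') (hne : u' ≠ v) :
    pairWeight x y z v v' v u' = freeWeight x y z u' v' := by
  rw [freeWeight, restrictedWeight]
  refine finsum_mem_eq_of_bijOn Prod.snd ⟨?_, ?_, ?_⟩ ?_
  all_goals
    have key : ∀ P ∈ disjointPairs v v' v u', P.1 = [] ∧ P.2 ∈ paths u' v' := fun P hP => by
      rcases hP.1 with hP | hP
      · exact ⟨eq_nil_of_mem_paths_self hP.1, hP.2⟩
      · rcases level_le_of_mem_paths hP.2 with h1 | h1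
        · exact absurd h1.symm hne
        · omega
  · exact fun P hP => ⟨(key P hP).2, fun _ _ => trivial⟩
  · exact fun P hP P' hP' h => Prod.ext ((key P hP).1.trans (key P' hP').1.symm) h
  · rintro q ⟨hq, -⟩
    refine ⟨([], q), ⟨Or.inl ⟨mem_paths_nil.2 rfl, hq⟩, ?_⟩, rfl⟩
    simp only [vertices, List.singleton_disjoint]
    intro hv
    rcases eq_or_level_lt_of_mem_vertices hv with h1 | h1
    · exact hne h1.symm
    · omega
  · intro P hP
    rw [(key P hP).1]
    simp [pathWeight]

theorem nonIntersectingWeight_pair (u u' v v' : ℤ × ℤ) :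
    nonIntersectingWeight x y z ![u, u'] ![v, v'] = pairWeight x y z v v' u u' := by
  refine finsum_mem_eq_of_bijOn (finTwoArrowEquiv (List Step)) ?_ fun P _ => ?_
  · refine (Equiv.bijOn _ fun P => ?_)
    simp only [disjointPairs, nonIntersectingFamilies, finTwoArrowEquiv_apply, Set.mem_ofPred_eq]
    have h : (∃ π : Equiv.Perm (Fin 2), ∀ i, P i ∈ paths (![u, u'] i) (![v, v'] (π i))) ↔
        (P 0 ∈ paths u v ∧ P 1 ∈ paths u' v') ∨ (P 0 ∈ paths u v' ∧ P 1 ∈ paths u' v) := by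
      constructor
      · rintro ⟨π, hπ⟩
        have h0 := hπ 0
        have h1 := hπ 1
        have : π 0 ≠ π 1 := π.injective.ne (by decide)
        generalize π 0 = i at *
        generalize π 1 = j at *
        fin_cases i <;> fin_cases j <;> simp_all
      · rintro (h | h)
        · exact ⟨1, by simpa [Fin.forall_fin_two] using h⟩
        · exact ⟨Equiv.swap 0 1, by simpa [Fin.forall_fin_two] using h⟩
    rw [h]
    simp only [Fin.forall_fin_two, Matrix.cons_val_zero, Matrix.cons_val_one, ne_eq,
      not_true_eq_false, false_imp_iff, Fin.zero_eq_one_iff, Fin.one_eq_zero_iff]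
    simp [List.disjoint_comm]
  · simp [Fin.prod_univ_two]

/-- Two paths on the triangular lattice cannot cross without meeting. -/
theorem eq_or_sign_height_add_vec {u u' : ℤ × ℤ} (h : level u ≤ level u')
    (h2 : level u' ≤ level u + 2) (hu : height u ≠ height u') (s : Step) :
    u + s.vec = u' ∨ height (u + s.vec) ≠ height u' ∧
      (height (u + s.vec) - height u').sign = (height u - height u').sign := by
  by_cases hs : u + s.vec = u'
  · exact Or.inl hs
  right
  obtain ⟨p, q⟩ := u
  obtain ⟨p', q'⟩ := u'
  rcases lt_or_gt_of_ne hu with hlt | hlt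
  -- Level and height have the same parity, so with these level bounds a step to equal height would
  -- land on `u'` itself.
  · have : height ((p, q) + s.vec) < height (p', q') := by
      cases s <;> simp [level, height, Step.vec] at * <;> omega
    exact ⟨this.ne, by
      rw [Int.sign_eq_neg_one_of_neg (by omega), Int.sign_eq_neg_one_of_neg (by omega)]⟩
  · have : height (p', q') < height ((p, q) + s.vec) := by
      cases s <;> simp [level, height, Step.vec] at * <;> omega
    exact ⟨this.ne', by
      rw [Int.sign_eq_one_of_pos (by omega), Int.sign_eq_one_of_pos (by omega)]⟩

/-- Both sides obey the same recursion when the lagging point advances, and they agree once both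
points reach level `2m` or `2m + 1`. The last hypothesis excludes distinct points of equal height,
where the sign would wrongly annihilate the right-hand side. -/
theorem pairWeight_eq_bracket {m N : ℕ} (hmN : m < N) {u u' : ℤ × ℤ}
    (hm : level u ≤ 2 * m + 1) (hm' : level u' ≤ 2 * m + 1)
    (h : level u ≤ level u' + 2) (h' : level u' ≤ level u + 2)
    (hu : height u = height u' → u = u') :
    pairWeight x y z ((m : ℤ), (m : ℤ)) ((N : ℤ), (N : ℤ)) u u' =
      (Int.sign (height u - height u') : R) *
        (signedWeight x y z m N u * freeWeight x y z u' ((m : ℤ), (m : ℤ)) -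
          freeWeight x y z u ((m : ℤ), (m : ℤ)) * signedWeight x y z m N u') := by
  induction hk : (4 * m + 2 - level u - level u').toNat using Nat.strong_induction_on
    generalizing u u' with
  | _ k ih =>
    subst hk
    wlog hle : level u ≤ level u' generalizing u u'
    · rw [pairWeight_comm, this hm' hm h' h (fun e => (hu e.symm).symm) ?_ (by omega),
        ← neg_sub (height u), Int.sign_neg]
      · push_cast
        ring
      · intro j hj w w' h1 h2 h3 h4 h5 h6
        exact ih j (by omega) h1 h2 h3 h4 h5 h6
    rcases eq_or_ne u u' with rfl | hne
    · simp [pairWeight_self]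
    rcases lt_or_ge (level u) (2 * m) with hlt | hge
    · have hlev : ∀ n : ℕ, m ≤ n → u ≠ ((n : ℤ), (n : ℤ)) := by
        rintro n hn rfl
        simp only [level] at hlt
        omega
      have hs := eq_or_sign_height_add_vec hle h' (mt hu hne)
      have e (f g : ℤ × ℤ → R) (c d : R) : stepSum x y z f u * c - stepSum x y z g u * d =
          stepSum x y z (fun w => f w * c - g w * d) u := by
        simp only [stepSum]
        ring
      rw [pairWeight_eq_stepSum x y z hle hne (hlev m le_rfl) (hlev N hmN.le),
        signedWeight_eq_stepSum x y z hlt, freeWeight_eq_stepSum x y z (hlev m le_rfl),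
        e, ← stepSum_const_mul]
      refine stepSum_congr x y z fun s => ?_
      rcases hs s with hs | ⟨hs, hs'⟩
      -- The paths meet: the pair weight is zero, and so is the antisymmetric bracket.
      · rw [hs, pairWeight_self]
        ring
      · have hlv := level_lt_level_add_vec u s
        have hlv' : level (u + s.vec) ≤ level u + 2 := by
          cases s <;> simp [level, Step.vec] <;> omega
        rw [← hs']
        exact ih _ (by omega) (by omega) hm' (by omega) (by omega) (fun h => absurd h hs) rfl
    · have h0 {w : ℤ × ℤ} (hw : 2 * (m : ℤ) ≤ level w) (hwm : level w ≤ 2 * m + 1)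
          (hne : w ≠ ((m : ℤ), (m : ℤ))) : height w ≠ 0 := by
        intro h0
        refine hne (Prod.ext ?_ ?_) <;> simp only [level, height] at * <;> omega
      have hl : level ((m : ℤ), (m : ℤ)) = 2 * m := by simp only [level]; ring
      have hh : height ((m : ℤ), (m : ℤ)) = 0 := by simp [height]
      by_cases hum : u = ((m : ℤ), (m : ℤ))
      · subst hum
        have hne' := h0 (hge.trans hle) hm' hne.symm
        rw [pairWeight_target x y z hle hne.symm, freeWeight_self,
          signedWeight_of_height_eq_zero x y z hh, hh, zero_sub, zero_mul, one_mul, zero_sub,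
          signedWeight_of_le_level x y z (hge.trans hle), Int.sign_neg]
        push_cast
        rw [neg_mul_neg, sign_mul_sign_mul hne']
      · by_cases hum' : u' = ((m : ℤ), (m : ℤ))
        · subst hum'
          have hne' := h0 hge hm hum
          rw [pairWeight_comm, pairWeight_target x y z (hl.trans_le hge) hum, freeWeight_self,
            signedWeight_of_height_eq_zero x y z hh, hh, sub_zero, mul_zero, mul_one, sub_zero,
            signedWeight_of_le_level x y z hge, sign_mul_sign_mul hne']
        -- Neither point can still reach `(m, m)`, so everything vanishes.
        · rw [pairWeight_eq_zero x y z (by omega) (by omega) hum hum',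
            freeWeight_of_level_le x y z (by omega) hum,
            freeWeight_of_level_le x y z (by omega) hum']
          simp

/-- Until `u` reaches level `2a` only its path advances. From there the bracket applies, and the
signed weight of `(a, a)` vanishes. -/
theorem pairWeight_eq_mul_sum {a m N : ℕ} (ham : a ≤ m) (hmN : m < N) {u : ℤ × ℤ}
    (hu : level u ≤ 2 * a + 1) (h0 : 0 ≤ u.1) (h0' : 0 ≤ u.2) :
    pairWeight x y z ((m : ℤ), (m : ℤ)) ((N : ℤ), (N : ℤ)) u ((a : ℤ), (a : ℤ)) =
      delannoyWeight x y z (m - a) (m - a) * ∑ n ∈ Finset.Ioc m N,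
        excursionWeight x y z a n u * delannoyWeight x y z (N - n) (N - n) := by
  have hl : level ((a : ℤ), (a : ℤ)) = 2 * a := by simp only [level]; ring
  have hh : height ((a : ℤ), (a : ℤ)) = 0 := by simp [height]
  induction hk : (2 * (a : ℤ) - level u).toNat using Nat.strong_induction_on generalizing u with
  | _ k ih =>
    subst hk
    rcases lt_or_ge (level u) (2 * a) with hlt | hge
    · have hlev : ∀ n : ℕ, a ≤ n → u ≠ ((n : ℤ), (n : ℤ)) := by
        rintro n hn rfl
        simp only [level] at hlt
        omega
      rw [pairWeight_eq_stepSum x y z (by omega) (hlev a le_rfl) (hlev m ham) (hlev N (by omega)),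
        Finset.sum_congr rfl fun n hn => by
          rw [excursionWeight_eq_stepSum x y z (by have := Finset.mem_Ioc.1 hn; omega) hlt h0,
            ← stepSum_mul_const], ← stepSum_sum, ← stepSum_const_mul]
      refine stepSum_congr x y z fun s => ih _ ?_ ?_ ?_ ?_ rfl
      · have := level_lt_level_add_vec u s
        omega
      all_goals cases s <;> simp [level, Step.vec] at * <;> omega
    · rw [pairWeight_eq_bracket x y z hmN (by omega) (by omega) (by omega) (by omega) ?_,
        signedWeight_of_height_eq_zero x y z hh, hh, sub_zero, mul_zero, sub_zero,
        freeWeight_diagonal x y z (n := m - a) (by omega), signedWeight, ← mul_assoc, mul_comm,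
        Finset.mul_sum]
      · congr 1
        refine Finset.sum_congr rfl fun n _ => ?_
        rw [excursionWeight_of_le_level x y z hge]
        ring
      · intro h
        rw [hh] at h
        refine Prod.ext ?_ ?_ <;> simp only [level, height] at * <;> omega

end Pairs

end TriangularLattice

theorem mainTheorem2 {R : Type*} [CommRing R] (x y z : R) (a b c : ℕ) (ha : 0 < a) (hc : 0 < c) :
    TriangularLattice.nonIntersectingWeight x y z
        ![((0 : ℤ), (0 : ℤ)), ((a : ℤ), (a : ℤ))]
        ![((a : ℤ) + b, (a : ℤ) + b), ((a : ℤ) + b + c, (a : ℤ) + b + c)] =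
      2 * (x * y) * TriangularLattice.delannoyWeight x y z b b *
        ∑ i ∈ Finset.Icc 1 a, ∑ j ∈ Finset.Icc 1 c,
          TriangularLattice.schroderWeight x y z (b + i + j - 1) *
            TriangularLattice.delannoyWeight x y z (a - i) (a - i) *
            TriangularLattice.delannoyWeight x y z (c - j) (c - j) ∧
    (∀ n k : ℕ, TriangularLattice.delannoyWeight x y z n k =
      ∑ i ∈ Finset.range (n + 1),
        (n.choose i : R) * (k.choose i : R) * x ^ (n - i) * y ^ (k - i) * (x * y + z) ^ i) ∧
    (∀ n : ℕ, TriangularLattice.schroderWeight x y z n =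
      ∑ i ∈ Finset.range (n + 1),
        (((2 * i).choose i / (i + 1) : ℕ) : R) * ((n + i).choose (n - i) : R) *
          x ^ i * y ^ i * z ^ (n - i)) := by
  refine ⟨?_, TriangularLattice.delannoyWeight_eq x y z, TriangularLattice.schroderWeight_eq x y z⟩
  have h := TriangularLattice.pairWeight_eq_mul_sum x y z (a := a) (m := a + b) (N := a + b + c)
    (u := (0, 0)) (by omega) (by omega) (by simp [TriangularLattice.level]; omega) le_rfl le_rfl
  push_cast at h
  rw [TriangularLattice.nonIntersectingWeight_pair, h, Nat.add_sub_cancel_left, Finset.sum_comm]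
  have hIoc : Finset.Ioc (a + b) (a + b + c) = (Finset.Icc 1 c).map (addLeftEmbedding (a + b)) := by
    rw [Finset.map_add_left_Icc]
    ext
    simp only [Finset.mem_Ioc, Finset.mem_Icc]
    omega
  rw [hIoc, Finset.sum_map, mul_comm (2 * (x * y)), mul_assoc]
  congr 1
  rw [Finset.mul_sum]
  refine Finset.sum_congr rfl fun j hj => ?_
  have := Finset.mem_Icc.1 hj
  -- The first return after `(a + b, a + b)` is at `n = a + b + j`, so `r = n - a - 1`; this needs
  -- `j ≥ 1`.
  have he := TriangularLattice.excursionWeight_zero x y z a (b + j - 1)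
  rw [show a + (b + j - 1) + 1 = a + b + j by omega] at he
  rw [addLeftEmbedding_apply, he, show a + b + c - (a + b + j) = c - j by omega, mul_assoc,
    Finset.sum_mul]
  congr 1
  refine Finset.sum_congr rfl fun i hi => ?_
  have := Finset.mem_Icc.1 hi
  rw [show b + j - 1 + i = b + i + j - 1 by omega]
  ring
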